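/- Let $G$ be a connected complex linear algebraic group (a Zariski closed, Zariski connected subgroup of some $\mathrm{GL}_m(\mathbb C)$), let $V$ be a finite-dimensional complex vector space, and let $\rho:G\to \mathrm{GL}(V)$ be a rational representation such that $G$ has a Zariski open orbit $\Omega$ in $V$ (so $(G,\rho,V)$ is a prehomogeneous vector space). A nonzero rational function $f$ on $V$ is a \emph{relative invariant} with rational character $\chi:G\to\mathbb C^*$ if $f(\rho(g)(v))=\chi(g)f(v)$ for all $v\in\Omega$, $g\in G$ (in particular $f$ has no poles on $\Omega$); we write $f\leftrightarrow\chi$. A rational function $h$ on $V$ is an \emph{additive relative invariant} if there is a homomorphism of algebraic groups $\Phi:G\to(\mathbb C,+)$ such that $h(\rho(g)(v))-h(v)=\Phi(g)$ for all $v\in\Omega$, $g\in G$ (in particular $h$ has no poles on $\Omega$). For polynomials $p,q,f$ on $V$ with $f$ irreducible, $p$ and $q$ \emph{agree to order $k$ on $V(f)$} if $p-q\in (f)^{k+1}$, an ideal power in $\mathbb C[V]$. Let $f_1,\dots,f_r$ be the basic relative invariants of $(G,\rho,V)$, i.e. irreducible polynomials whose zero sets are the distinct irreducible hypersurface components of $V\setminus\Omega$,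 with $f_i\leftrightarrow\chi_i$. Let $h=h_1/f$, where $h_1,f$ are homogeneous polynomials on $V$ of the same degree with no common factors, and $f=f_1^{k_1}\cdots f_r^{k_r}$ with integers $k_i\ge 0$. Let $\chi=\chi_1^{k_1}\cdots\chi_r^{k_r}$. Then the following are equivalent: \begin{enumerate} \item $h$ is an additive relative invariant. \item For all $i$ with $k_i>0$ and all $g\in G$, the polynomials $h_1\circ\rho(g)$ and $\chi(g)\,h_1$ agree to order $k_i-1$ on $V(f_i)$. \item For all $g\in G$, the polynomial $h_1\circ\rho(g)-\chi(g)\,h_1\in\mathbb C[V]$ is divisible by $f$. \end{enumerate} Moreover, if $f$ is reduced (squarefree) and $V_\epsilon=\{x\in V: f(x)=h_1(x)-\epsilon=0\}$ for $\epsilon\in\mathbb C$, then $h$ is an additive relative invariant if and only if $\rho(g)(V_\epsilon)=V_{\chi(g)\epsilon}$ for all $g\in G$ and all $\epsilon\in\mathbb C$. -/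

import Mathlib

open scoped Topology

noncomputable section

namespace PVS

/-- The Zariski topology on a set `X` defined by a family `A` of (regular) functions `X → ℂ`: the
topology generated by the nonvanishing loci of the members of `A`. -/
abbrev zariskiTopology {X : Type*} (A : Set (X → ℂ)) : TopologicalSpace X :=
  TopologicalSpace.generateFrom {U | ∃ φ ∈ A, U = {x | φ x ≠ 0}}

section Group

/-- The coordinate ring of `GL_m(ℂ)`, as an algebra of functions: it is generated by the matrix
entries and the inverse of the determinant. -/
def coordGL (m : ℕ) : Subalgebra ℂ (GL (Fin m) ℂ → ℂ) :=
  Algebra.adjoin ℂ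
    ({φ | ∃ i j : Fin m, φ = fun g : GL (Fin m) ℂ => (g : Matrix (Fin m) (Fin m) ℂ) i j} ∪
      {fun g : GL (Fin m) ℂ => ((g : Matrix (Fin m) (Fin m) ℂ).det)⁻¹})

/-- The Zariski topology of `GL_m(ℂ)`. -/
abbrev zariskiGL (m : ℕ) : TopologicalSpace (GL (Fin m) ℂ) :=
  zariskiTopology (coordGL m : Set (GL (Fin m) ℂ → ℂ))

variable {m : ℕ}

/-- `G` is a connected complex linear algebraic group: a Zariski closed subgroup of `GL_m(ℂ)` that
is connected in the Zariski topology. -/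
structure IsConnectedLinearAlgebraicGroup (G : Subgroup (GL (Fin m) ℂ)) : Prop where
  isClosed : IsClosed[zariskiGL m] (G : Set (GL (Fin m) ℂ))
  isConnected : @IsConnected _ (zariskiGL m) (G : Set (GL (Fin m) ℂ))

variable {G : Subgroup (GL (Fin m) ℂ)}

/-- Regular functions on `G`: restrictions of regular functions on `GL_m(ℂ)`. -/
def IsRegular (φ : G → ℂ) : Prop :=
  ∃ ψ ∈ coordGL m, ∀ g : G, φ g = ψ g

/-- `χ` belongs to `X(G)`: it is a rational (multiplicative) character, that is, a homomorphism
`G → 𝔾ₘ` of algebraic groups. -/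
def IsRationalCharacter (χ : G →* ℂˣ) : Prop :=
  IsRegular fun g => (χ g : ℂ)

/-- `Φ` belongs to `𝒜(G)`: it is an additive function of `G`, that is, a homomorphism `G → 𝔾ₐ` of
algebraic groups. -/
structure IsAdditiveFunction (Φ : G → ℂ) : Prop where
  map_mul : ∀ g g' : G, Φ (g * g') = Φ g + Φ g'
  isRegular : IsRegular Φ

end Group

section Space

variable {n : ℕ} {V : Type*} [AddCommGroup V] [Module ℂ V]

/-! The coordinate ring `ℂ[V]` is the polynomial ring in the coordinates of a basis `b` of `V`. -/

/-- The value of a polynomial `p ∈ ℂ[V]` at a vector `v`. -/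
def polyEval (b : Module.Basis (Fin n) ℂ V) (p : MvPolynomial (Fin n) ℂ) (v : V) : ℂ :=
  MvPolynomial.eval (b.repr v) p

/-- The polynomial `p ∘ T` for `p ∈ ℂ[V]` and a linear endomorphism `T` of `V`. -/
def polyComp (b : Module.Basis (Fin n) ℂ V) (p : MvPolynomial (Fin n) ℂ) (T : V →ₗ[ℂ] V) :
    MvPolynomial (Fin n) ℂ :=
  MvPolynomial.bind₁ (LinearMap.toMvPolynomial b b T) p

theorem polyEval_polyComp (b : Module.Basis (Fin n) ℂ V) (p : MvPolynomial (Fin n) ℂ)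
    (T : V →ₗ[ℂ] V) (v : V) : polyEval b (polyComp b p T) v = polyEval b p (T v) := by
  have key : (MvPolynomial.eval (b.repr v)).comp
      (MvPolynomial.bind₁ (LinearMap.toMvPolynomial b b T)).toRingHom =
      MvPolynomial.eval (b.repr (T v)) := by
    apply MvPolynomial.ringHom_ext
    · intro c
      simp
    · intro i
      simp [LinearMap.toMvPolynomial_eval_eq_apply]
  exact DFunLike.congr_fun key p

/-- The hypersurface `V(p)`, i.e. the set of zeros of `p` in `V`. -/
def zeroSet (b : Module.Basis (Fin n) ℂ V) (p : MvPolynomial (Fin n) ℂ) : Set V :=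
  {v | polyEval b p v = 0}

/-- The Zariski topology of the vector space `V`. -/
abbrev zariskiSpace (b : Module.Basis (Fin n) ℂ V) : TopologicalSpace V :=
  zariskiTopology (Set.range (polyEval b))

/-- `p` and `q` agree to order `k` on `V(f)`. -/
def AgreeToOrder (k : ℕ) (f p q : MvPolynomial (Fin n) ℂ) : Prop :=
  p - q ∈ Ideal.span {f} ^ (k + 1)

/-- The rational functions on `V`. -/
abbrev RatFun (n : ℕ) : Type := FractionRing (MvPolynomial (Fin n) ℂ)

/-- The rational function `p / q`. -/
def ratMk (p q : MvPolynomial (Fin n) ℂ) : RatFun n :=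
  algebraMap (MvPolynomial (Fin n) ℂ) (RatFun n) p / algebraMap (MvPolynomial (Fin n) ℂ) (RatFun n) q

/-- The rational function `h` is defined (has no pole) at `v`, and its value there is `c`. -/
def HasValueAt (b : Module.Basis (Fin n) ℂ V) (h : RatFun n) (v : V) (c : ℂ) : Prop :=
  ∃ p q : MvPolynomial (Fin n) ℂ,
    polyEval b q v ≠ 0 ∧ h = ratMk p q ∧ c = polyEval b p v / polyEval b q v

theorem HasValueAt.unique {b : Module.Basis (Fin n) ℂ V} {h : RatFun n} {v : V} {c c' : ℂ}
    (hc : HasValueAt b h v c) (hc' : HasValueAt b h v c') : c = c' := by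
  obtain ⟨p, q, hq, e, rfl⟩ := hc
  obtain ⟨p', q', hq', e', rfl⟩ := hc'
  have inj := IsFractionRing.injective (MvPolynomial (Fin n) ℂ) (RatFun n)
  have q0 : algebraMap _ (RatFun n) q ≠ 0 := by
    rw [Ne, map_eq_zero_iff _ inj]; rintro rfl; simp [polyEval] at hq
  have q0' : algebraMap _ (RatFun n) q' ≠ 0 := by
    rw [Ne, map_eq_zero_iff _ inj]; rintro rfl; simp [polyEval] at hq'
  rw [e, ratMk, ratMk, div_eq_div_iff q0 q0', ← map_mul, ← map_mul] at e'
  have e2 := congrArg (MvPolynomial.eval (b.repr v)) (inj e')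
  rw [map_mul, map_mul] at e2
  rw [div_eq_div_iff hq hq']
  exact e2

end Space

section Prehomogeneous

variable {m n : ℕ} {G : Subgroup (GL (Fin m) ℂ)} {V : Type*} [AddCommGroup V] [Module ℂ V]

/-- `ρ` is a rational representation, that is, a homomorphism `G → GL(V)` of algebraic groups:
its matrix coefficients are regular functions on `G`. -/
def IsRationalRepresentation (ρ : Representation ℂ G V) : Prop :=
  ∀ (v : V) (l : Module.Dual ℂ V), IsRegular fun g : G => l (ρ g v)

/-- `(G, ρ, V)` is a prehomogeneous vector space with open orbit `Ω`. -/
structure IsPrehomogeneous (b : Module.Basis (Fin n) ℂ V) (ρ : Representation ℂ G V)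
    (Ω : Set V) : Prop where
  group : IsConnectedLinearAlgebraicGroup G
  rational : IsRationalRepresentation ρ
  isOrbit : ∃ v₀ : V, Ω = Set.range fun g : G => ρ g v₀
  isOpen : IsOpen[zariskiSpace b] Ω

/-- `S` is an irreducible component of the exceptional orbit variety `V ∖ Ω`, and it is a
hypersurface. -/
def IsHypersurfaceComponent (b : Module.Basis (Fin n) ℂ V) (Ω S : Set V) : Prop :=
  Maximal (fun T : Set V => @IsIrreducible V (zariskiSpace b) T ∧ T ⊆ Ωᶜ) S ∧
    ∃ p : MvPolynomial (Fin n) ℂ, p.totalDegree ≠ 0 ∧ S = zeroSet b p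

/-- The rational function `f` is a relative invariant with character `χ`: `f` is not identically
zero, and `f(ρ(g)(v)) = χ(g) f(v)` for all `v ∈ Ω` and `g ∈ G`. -/
structure IsRelativeInvariantFor (b : Module.Basis (Fin n) ℂ V) (ρ : Representation ℂ G V)
    (Ω : Set V) (f : RatFun n) (χ : G →* ℂˣ) : Prop where
  ne_zero : f ≠ 0
  character : IsRationalCharacter χ
  equation : ∀ g : G, ∀ v ∈ Ω, ∃ c : ℂ, HasValueAt b f v c ∧ HasValueAt b f (ρ g v) (χ g * c)

/-- `f 0, …, f (r - 1)` are the basic relative invariants: irreducible polynomials whose zero sets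
are the distinct irreducible hypersurface components of `V ∖ Ω`. -/
structure AreBasicRelativeInvariants (b : Module.Basis (Fin n) ℂ V) (Ω : Set V) {r : ℕ}
    (f : Fin r → MvPolynomial (Fin n) ℂ) : Prop where
  irreducible : ∀ i, Irreducible (f i)
  injective : Function.Injective fun i => zeroSet b (f i)
  range_eq : (Set.range fun i => zeroSet b (f i)) = {S | IsHypersurfaceComponent b Ω S}

/-- The rational function `h` is an additive relative invariant: for some additive function `Φ`
of `G`, `h(ρ(g)(v)) - h(v) = Φ(g)` for all `v ∈ Ω` and `g ∈ G`. -/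
def IsAdditiveRelativeInvariant (b : Module.Basis (Fin n) ℂ V) (ρ : Representation ℂ G V)
    (Ω : Set V) (h : RatFun n) : Prop :=
  ∃ Φ : G → ℂ, IsAdditiveFunction Φ ∧
    ∀ g : G, ∀ v ∈ Ω, ∃ a c : ℂ, HasValueAt b h (ρ g v) a ∧ HasValueAt b h v c ∧ a - c = Φ g

/-- The set `V_ε = {x | f(x) = h₁(x) - ε = 0}`. -/
def levelSet (b : Module.Basis (Fin n) ℂ V) (f h₁ : MvPolynomial (Fin n) ℂ) (ε : ℂ) : Set V :=
  {x | polyEval b f x = 0 ∧ polyEval b h₁ x - ε = 0}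

end Prehomogeneous

end PVS

end

/-! Since `F ∘ ρ g = X g • F`, on `Ω` one has `h (ρ g v) - h v = (h₁ ∘ ρ g - X g • h₁) v / (X g * F
v)`. If this equals `Φ g`, density of `Ω` gives the polynomial identity `h₁ ∘ ρ g - X g • h₁ = X g *
Φ g * F`, hence divisibility by `F`. Conversely, numerator and `F` are homogeneous of the same
degree, so divisibility forces a constant quotient `c g`, and `Φ = c / X` is additive and regular.
Divisibility by `F` splits into divisibility by each `f i ^ k i` because the `f i` are pairwise
non-associated irreducibles. For squarefree `F` the Nullstellensatz turns divisibility into `h₁ (ρ g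
v) = X g * h₁ v` on `V(F)`, which is what the level sets record. -/

namespace PVS

/-! ### Regular functions and rational characters. -/

section Group

variable {m : ℕ}

theorem det_mem_of_forall_mem {X ι : Type*} [Fintype ι] [DecidableEq ι]
    {A : Subalgebra ℂ (X → ℂ)} (M : X → Matrix ι ι ℂ)
    (hM : ∀ i j, (fun x => M x i j) ∈ A) : (fun x => (M x).det) ∈ A := by
  have h : (fun x => (M x).det) =
      ∑ σ : Equiv.Perm ι, ((Equiv.Perm.sign σ : ℤ) : ℂ) • ∏ i, fun x => M x (σ i) i := by
    funext x
    simp [Matrix.det_apply', Finset.sum_apply, Finset.prod_apply]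
  rw [h]
  exact A.sum_mem fun σ _ => A.smul_mem (A.prod_mem fun i _ => hM _ _) _

theorem entry_mem_coordGL (i j : Fin m) :
    (fun g : GL (Fin m) ℂ => (g : Matrix (Fin m) (Fin m) ℂ) i j) ∈ coordGL m :=
  Algebra.subset_adjoin (Or.inl ⟨i, j, rfl⟩)

theorem det_inv_mem_coordGL :
    (fun g : GL (Fin m) ℂ => ((g : Matrix (Fin m) (Fin m) ℂ).det)⁻¹) ∈ coordGL m :=
  Algebra.subset_adjoin (Or.inr rfl)

theorem entry_inv_mem_coordGL (i j : Fin m) :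
    (fun g : GL (Fin m) ℂ => ((g⁻¹ : GL (Fin m) ℂ) : Matrix (Fin m) (Fin m) ℂ) i j) ∈
      coordGL m := by
  have h : (fun g : GL (Fin m) ℂ => ((g⁻¹ : GL (Fin m) ℂ) : Matrix (Fin m) (Fin m) ℂ) i j) =
      (fun g : GL (Fin m) ℂ => ((g : Matrix (Fin m) (Fin m) ℂ).det)⁻¹) *
        fun g : GL (Fin m) ℂ => (g : Matrix (Fin m) (Fin m) ℂ).adjugate i j := by
    funext g
    simp [Matrix.coe_units_inv, Matrix.inv_def]
  rw [h]
  refine (coordGL m).mul_mem det_inv_mem_coordGL ?_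
  -- An adjugate entry is the determinant of the matrix with row `j` replaced by a basis vector.
  simp only [Matrix.adjugate_apply]
  refine det_mem_of_forall_mem _ fun k l => ?_
  by_cases hk : k = j
  · subst hk
    simp only [Matrix.updateRow_self]
    exact (coordGL m).algebraMap_mem (Pi.single (M := fun _ : Fin m => ℂ) i 1 l)
  · simpa [Matrix.updateRow_ne hk] using entry_mem_coordGL k l

/-- Inversion is a morphism of varieties. This is what makes `1 / X`, and so `Φ = c / X`, regular.
-/
theorem comp_inv_mem_coordGL {ψ : GL (Fin m) ℂ → ℂ} (hψ : ψ ∈ coordGL m) :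
    (fun g => ψ g⁻¹) ∈ coordGL m := by
  induction hψ using Algebra.adjoin_induction with
  | mem x hx =>
    rcases hx with ⟨i, j, rfl⟩ | rfl
    · exact entry_inv_mem_coordGL i j
    · have h : (fun g : GL (Fin m) ℂ =>
          (((g⁻¹ : GL (Fin m) ℂ) : Matrix (Fin m) (Fin m) ℂ).det)⁻¹) =
          fun g : GL (Fin m) ℂ => (g : Matrix (Fin m) (Fin m) ℂ).det := by
        funext g
        simp [Matrix.coe_units_inv, Matrix.det_nonsing_inv]
      exact h ▸ det_mem_of_forall_mem _ entry_mem_coordGL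
  | algebraMap c => exact (coordGL m).algebraMap_mem c
  | add x y _ _ hx hy => exact (coordGL m).add_mem hx hy
  | mul x y _ _ hx hy => exact (coordGL m).mul_mem hx hy

variable {G : Subgroup (GL (Fin m) ℂ)}

theorem isRegular_const (c : ℂ) : IsRegular fun _ : G => c :=
  ⟨fun _ => c, (coordGL m).algebraMap_mem c, fun _ => rfl⟩

theorem IsRegular.add {φ ψ : G → ℂ} (hφ : IsRegular φ) (hψ : IsRegular ψ) :
    IsRegular fun g => φ g + ψ g := by
  obtain ⟨φ', h, e⟩ := hφ
  obtain ⟨ψ', h', e'⟩ := hψ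
  exact ⟨φ' + ψ', (coordGL m).add_mem h h', fun g => by simp [e, e']⟩

theorem IsRegular.mul {φ ψ : G → ℂ} (hφ : IsRegular φ) (hψ : IsRegular ψ) :
    IsRegular fun g => φ g * ψ g := by
  obtain ⟨φ', h, e⟩ := hφ
  obtain ⟨ψ', h', e'⟩ := hψ
  exact ⟨φ' * ψ', (coordGL m).mul_mem h h', fun g => by simp [e, e']⟩

theorem IsRegular.comp_inv {φ : G → ℂ} (hφ : IsRegular φ) : IsRegular fun g => φ g⁻¹ := by
  obtain ⟨ψ, h, e⟩ := hφ
  exact ⟨_, comp_inv_mem_coordGL h, fun g => by simp [e]⟩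

theorem IsRationalCharacter.mul {χ χ' : G →* ℂˣ} (h : IsRationalCharacter χ)
    (h' : IsRationalCharacter χ') : IsRationalCharacter (χ * χ') := by
  simpa [IsRationalCharacter] using IsRegular.mul h h'

theorem isRationalCharacter_one : IsRationalCharacter (1 : G →* ℂˣ) := by
  simpa [IsRationalCharacter] using isRegular_const (G := G) 1

theorem IsRationalCharacter.pow {χ : G →* ℂˣ} (h : IsRationalCharacter χ) (k : ℕ) :
    IsRationalCharacter (χ ^ k) := by
  have hk : IsRegular fun g => (χ g : ℂ) ^ k := by
    induction k with
    | zero => simpa using isRegular_const (G := G) 1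
    | succ k ih => simpa only [pow_succ] using ih.mul h
  simpa [IsRationalCharacter] using hk

theorem isRationalCharacter_prod {ι : Type*} (s : Finset ι) {χ : ι → G →* ℂˣ}
    (h : ∀ i ∈ s, IsRationalCharacter (χ i)) : IsRationalCharacter (∏ i ∈ s, χ i) :=
  Finset.prod_induction _ _ (fun _ _ => IsRationalCharacter.mul) isRationalCharacter_one h

theorem IsRationalCharacter.isRegular_inv {χ : G →* ℂˣ} (h : IsRationalCharacter χ) :
    IsRegular fun g => (χ g : ℂ)⁻¹ := by
  simpa using IsRegular.comp_inv h

end Group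

/-! ### Polynomials and the Zariski topology on `V`. -/

section Space

variable {n : ℕ} {V : Type*} [AddCommGroup V] [Module ℂ V] (b : Module.Basis (Fin n) ℂ V)

theorem exists_polyEval_eq_eval (x : Fin n → ℂ) :
    ∃ v : V, ∀ p, polyEval b p v = MvPolynomial.eval x p := by
  refine ⟨b.equivFun.symm x, fun p => ?_⟩
  have h : (b.repr (b.equivFun.symm x) : Fin n → ℂ) = x := b.equivFun.apply_symm_apply x
  rw [polyEval, h]

theorem polyEval_ext {p q : MvPolynomial (Fin n) ℂ} (h : ∀ v, polyEval b p v = polyEval b q v) :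
    p = q := by
  refine MvPolynomial.funext fun x => ?_
  obtain ⟨v, hv⟩ := exists_polyEval_eq_eval b x
  rw [← hv, ← hv, h]

variable {b}

/-- Nonvanishing loci are stable under finite intersection (multiply the polynomials), so the
generating family is already a basis. -/
theorem exists_basicOpen_subset {U : Set V} (hU : IsOpen[zariskiSpace b] U) {v : V}
    (hv : v ∈ U) : ∃ q, polyEval b q v ≠ 0 ∧ ∀ w, polyEval b q w ≠ 0 → w ∈ U := by
  change TopologicalSpace.GenerateOpen _ U at hU
  induction hU with
  | basic s hs =>
    obtain ⟨_, ⟨q, rfl⟩, rfl⟩ := hs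
    exact ⟨q, hv, fun _ h => h⟩
  | univ => exact ⟨1, by simp [polyEval], fun _ _ => trivial⟩
  | inter s t _ _ hs ht =>
    obtain ⟨q, hq, hqs⟩ := hs hv.1
    obtain ⟨q', hq', hqt⟩ := ht hv.2
    refine ⟨q * q', by simpa [polyEval] using ⟨hq, hq'⟩, fun w hw => ?_⟩
    rw [polyEval, map_mul] at hw
    exact ⟨hqs w (left_ne_zero_of_mul hw), hqt w (right_ne_zero_of_mul hw)⟩
  | sUnion S _ ih =>
    obtain ⟨s, hs, hvs⟩ := hv
    obtain ⟨q, hq, hqs⟩ := ih s hs hvs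
    exact ⟨q, hq, fun w hw => ⟨s, hs, hqs w hw⟩⟩

/-- A nonempty Zariski open set is Zariski dense. -/
theorem eq_of_polyEval_eqOn {U : Set V} (hU : IsOpen[zariskiSpace b] U) (hne : U.Nonempty)
    {p q : MvPolynomial (Fin n) ℂ} (h : ∀ v ∈ U, polyEval b p v = polyEval b q v) : p = q := by
  obtain ⟨v, hv⟩ := hne
  obtain ⟨s, hs, hsU⟩ := exists_basicOpen_subset hU hv
  -- At each point either `s` vanishes, or the point lies in `U` and `p - q` vanishes.
  have h0 : (p - q) * s = 0 := by
    refine polyEval_ext b fun w => ?_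
    by_cases hw : polyEval b s w = 0
    · rw [polyEval] at hw
      simp [polyEval, hw]
    · have := h w (hsU w hw)
      rw [polyEval, polyEval] at this
      simp [polyEval, this]
  have hs0 : s ≠ 0 := by
    rintro rfl
    simp [polyEval] at hs
  exact sub_eq_zero.1 ((mul_eq_zero.1 h0).resolve_right hs0)

theorem hasValueAt_ratMk {p q : MvPolynomial (Fin n) ℂ} {v : V} (hq : polyEval b q v ≠ 0) :
    HasValueAt b (ratMk p q) v (polyEval b p v / polyEval b q v) :=
  ⟨p, q, hq, rfl, rfl⟩

theorem isHomogeneous_polyComp {p : MvPolynomial (Fin n) ℂ} {d : ℕ} (hp : p.IsHomogeneous d)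
    (T : V →ₗ[ℂ] V) : (polyComp b p T).IsHomogeneous d := by
  have h := hp.aeval (LinearMap.toMvPolynomial b b T)
    (LinearMap.toMvPolynomial_isHomogeneous b b T)
  rwa [one_mul] at h

/-- The Nullstellensatz for a squarefree polynomial. -/
theorem dvd_of_squarefree_of_zeroSet_subset {p q : MvPolynomial (Fin n) ℂ} (hp : Squarefree p)
    (h : zeroSet b p ⊆ zeroSet b q) : p ∣ q := by
  have hq : q ∈ (Ideal.span {p}).radical := by
    rw [← MvPolynomial.vanishingIdeal_zeroLocus_eq_radical (K := ℂ)]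
    intro x hx
    obtain ⟨v, hv⟩ := exists_polyEval_eq_eval b x
    have hpx : MvPolynomial.eval x p = 0 := by
      simpa using hx p (Ideal.mem_span_singleton_self p)
    have : polyEval b q v = 0 := h (show polyEval b p v = 0 by rw [hv, hpx])
    rw [hv] at this
    simpa using this
  obtain ⟨k, hk⟩ := hq
  exact hp.isRadical k q (Ideal.mem_span_singleton.1 hk)

end Space

/-- Degrees add in a domain, so the cofactor has degree zero; the case `q = 0` is apart, its degree
being uninformative. -/
theorem exists_eq_C_mul_of_dvd {σ R : Type*} [CommRing R] [IsDomain R] {p q : MvPolynomial σ R}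
    {d : ℕ} (hp : p.IsHomogeneous d) (hq : q.IsHomogeneous d) (h : p ∣ q) :
    ∃ c : R, q = MvPolynomial.C c * p := by
  obtain ⟨c, rfl⟩ := h
  by_cases h0 : p * c = 0
  · exact ⟨0, by simp [h0]⟩
  · have h1 := hq.totalDegree h0
    rw [MvPolynomial.totalDegree_mul_of_isDomain (left_ne_zero_of_mul h0)
      (right_ne_zero_of_mul h0), hp.totalDegree (left_ne_zero_of_mul h0)] at h1
    have hc := MvPolynomial.totalDegree_eq_zero_iff_eq_C.1 (by omega : c.totalDegree = 0)
    exact ⟨c.coeff 0, by rw [mul_comm, ← hc]⟩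

theorem prod_pow_dvd_iff {ι R : Type*} [Fintype ι] [CommRing R] [IsDomain R]
    [UniqueFactorizationMonoid R] {f : ι → R} (hf : ∀ i, Irreducible (f i))
    (hne : ∀ i j, i ≠ j → ¬ Associated (f i) (f j)) (k : ι → ℕ) (q : R) :
    ∏ i, f i ^ k i ∣ q ↔ ∀ i, f i ^ k i ∣ q := by
  refine ⟨fun h i => (Finset.dvd_prod_of_mem _ (Finset.mem_univ i)).trans h, fun h =>
    Finset.prod_dvd_of_isRelPrime (fun i _ j _ hij => ?_) fun i _ => h i⟩
  refine IsRelPrime.pow ((hf i).isRelPrime_iff_not_dvd.2 fun hd => hne i j hij ?_)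
  exact (hf i).associated_of_dvd (hf j) hd

/-! ### Relative invariants and the open orbit. -/

section Prehomogeneous

variable {m n : ℕ} {G : Subgroup (GL (Fin m) ℂ)} {V : Type*} [AddCommGroup V] [Module ℂ V]
  {b : Module.Basis (Fin n) ℂ V} {ρ : Representation ℂ G V} {Ω : Set V}

theorem IsRationalRepresentation.isRegular_polyEval (hρ : IsRationalRepresentation ρ)
    (p : MvPolynomial (Fin n) ℂ) (v : V) : IsRegular fun g => polyEval b p (ρ g v) := by
  induction p using MvPolynomial.induction_on with
  | C c => simpa [polyEval] using isRegular_const (G := G) c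
  | add p q hp hq => simpa [polyEval] using hp.add hq
  | mul_X p i hp => simpa [polyEval] using hp.mul (hρ v (b.coord i))

theorem IsPrehomogeneous.nonempty (hρ : IsPrehomogeneous b ρ Ω) : Ω.Nonempty := by
  obtain ⟨v, rfl⟩ := hρ.isOrbit
  exact Set.range_nonempty _

theorem IsPrehomogeneous.map_mem (hρ : IsPrehomogeneous b ρ Ω) (g : G) {v : V} (hv : v ∈ Ω) :
    ρ g v ∈ Ω := by
  obtain ⟨v₀, rfl⟩ := hρ.isOrbit
  obtain ⟨g', rfl⟩ := hv
  exact ⟨g * g', by simp⟩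

/-- A polynomial relative invariant satisfies its functional equation as a polynomial. -/
theorem IsRelativeInvariantFor.polyComp_eq (hρ : IsPrehomogeneous b ρ Ω)
    {p : MvPolynomial (Fin n) ℂ} {χ : G →* ℂˣ}
    (h : IsRelativeInvariantFor b ρ Ω (ratMk p 1) χ) (g : G) :
    polyComp b p (ρ g) = (χ g : ℂ) • p := by
  refine eq_of_polyEval_eqOn hρ.isOpen hρ.nonempty fun v hv => ?_
  have value (w : V) : HasValueAt b (ratMk p 1) w (polyEval b p w) := by
    simpa [polyEval] using hasValueAt_ratMk (b := b) (p := p) (q := 1) (v := w) (by simp [polyEval])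
  obtain ⟨c, hc, hc'⟩ := h.equation g v hv
  rw [polyEval_polyComp, (value _).unique hc', hc.unique (value v)]
  simp [polyEval]

theorem polyComp_prod_pow {ι : Type*} [Fintype ι] {f : ι → MvPolynomial (Fin n) ℂ}
    {χ : ι → G →* ℂˣ} (h : ∀ i g, polyComp b (f i) (ρ g) = (χ i g : ℂ) • f i) (k : ι → ℕ)
    (g : G) : polyComp b (∏ i, f i ^ k i) (ρ g) =
      (((∏ i, χ i ^ k i) g : ℂˣ) : ℂ) • ∏ i, f i ^ k i := by
  have h' : ∀ i, MvPolynomial.bind₁ (LinearMap.toMvPolynomial b b (ρ g)) (f i) =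
      MvPolynomial.C (χ i g : ℂ) * f i := fun i => by
    rw [← MvPolynomial.smul_eq_C_mul]; exact h i g
  simp [polyComp, h', mul_pow, Finset.prod_mul_distrib, MvPolynomial.smul_eq_C_mul]

/-! ### Divisibility by `F`, additive invariance and level sets. -/

section Equivariant

variable {X : G →* ℂˣ} {h₁ F : MvPolynomial (Fin n) ℂ} {d : ℕ}

theorem polyEval_map_of_polyComp_eq
    (hFX : ∀ g, polyComp b F (ρ g) = (X g : ℂ) • F) (g : G) (v : V) :
    polyEval b F (ρ g v) = X g * polyEval b F v := by
  rw [← polyEval_polyComp, hFX]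
  simp [polyEval]

theorem IsAdditiveRelativeInvariant.dvd
    (hρ : IsPrehomogeneous b ρ Ω)
    (hFX : ∀ g, polyComp b F (ρ g) = (X g : ℂ) • F)
    (hFΩ : ∀ v ∈ Ω, polyEval b F v ≠ 0) (h : IsAdditiveRelativeInvariant b ρ Ω (ratMk h₁ F))
    (g : G) : F ∣ polyComp b h₁ (ρ g) - (X g : ℂ) • h₁ := by
  obtain ⟨Φ, -, hΦ⟩ := h
  refine ⟨MvPolynomial.C (X g * Φ g), ?_⟩
  refine eq_of_polyEval_eqOn hρ.isOpen hρ.nonempty fun v hv => ?_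
  obtain ⟨a, c, ha, hc, hac⟩ := hΦ g v hv
  rw [ha.unique (hasValueAt_ratMk (hFΩ _ (hρ.map_mem g hv))),
    hc.unique (hasValueAt_ratMk (hFΩ v hv)), polyEval_map_of_polyComp_eq hFX] at hac
  have h1 : polyEval b (polyComp b h₁ (ρ g) - (X g : ℂ) • h₁) v =
      polyEval b h₁ (ρ g v) - X g * polyEval b h₁ v := by
    rw [← polyEval_polyComp]; simp [polyEval]
  have h2 : polyEval b (F * MvPolynomial.C (X g * Φ g)) v =
      polyEval b F v * (X g * Φ g) := by simp [polyEval]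
  have hv0 := hFΩ v hv
  have hX0 : (X g : ℂ) ≠ 0 := (X g).ne_zero
  rw [h1, h2, ← hac]
  field_simp

theorem isAdditiveRelativeInvariant_of_dvd
    (hρ : IsPrehomogeneous b ρ Ω)
    (hFX : ∀ g, polyComp b F (ρ g) = (X g : ℂ) • F)
    (hFΩ : ∀ v ∈ Ω, polyEval b F v ≠ 0) (hX : IsRationalCharacter X)
    (hh₁ : h₁.IsHomogeneous d) (hF : F.IsHomogeneous d)
    (h : ∀ g : G, F ∣ polyComp b h₁ (ρ g) - (X g : ℂ) • h₁) :
    IsAdditiveRelativeInvariant b ρ Ω (ratMk h₁ F) := by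
  have hconst (g : G) : ∃ c : ℂ,
      polyComp b h₁ (ρ g) - (X g : ℂ) • h₁ = MvPolynomial.C c * F := by
    refine exists_eq_C_mul_of_dvd hF ((isHomogeneous_polyComp hh₁ _).sub ?_) (h g)
    rw [MvPolynomial.smul_eq_C_mul]
    simpa using (MvPolynomial.isHomogeneous_C (Fin n) (X g : ℂ)).mul hh₁
  choose c hc using hconst
  have hdiff (g : G) (v : V) (hv : v ∈ Ω) :
      polyEval b h₁ (ρ g v) / polyEval b F (ρ g v) - polyEval b h₁ v / polyEval b F v =
        c g / X g := by
    have h1 := congrArg (fun p => polyEval b p v) (hc g)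
    have h2 : polyEval b (polyComp b h₁ (ρ g) - (X g : ℂ) • h₁) v =
        polyEval b h₁ (ρ g v) - X g * polyEval b h₁ v := by
      rw [← polyEval_polyComp]; simp [polyEval]
    have h3 : polyEval b (MvPolynomial.C (c g) * F) v = c g * polyEval b F v := by
      simp [polyEval]
    simp only [h2, h3] at h1
    have hv0 := hFΩ v hv
    have hX0 : (X g : ℂ) ≠ 0 := (X g).ne_zero
    rw [polyEval_map_of_polyComp_eq hFX]
    field_simp
    linear_combination h1
  obtain ⟨v₀, hv₀⟩ := hρ.nonempty
  refine ⟨fun g => c g / X g, ⟨fun g g' => ?_, ?_⟩, fun g v hv => ⟨_, _,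
    hasValueAt_ratMk (hFΩ _ (hρ.map_mem g hv)), hasValueAt_ratMk (hFΩ v hv), hdiff g v hv⟩⟩
  -- The value of `hdiff` does not depend on the base point: the differences telescope along `v₀`,
  -- `ρ g' v₀`, `ρ g (ρ g' v₀)`.
  · rw [← hdiff (g * g') v₀ hv₀, ← hdiff g _ (hρ.map_mem g' hv₀), ← hdiff g' v₀ hv₀, map_mul,
      Module.End.mul_apply]
    ring
  -- At the fixed `v₀`, `Φ g = h₁ (ρ g v₀) * (X g)⁻¹ * (F v₀)⁻¹ - h v₀`.
  · have hreg := (((hρ.rational.isRegular_polyEval (b := b) h₁ v₀).mul hX.isRegular_inv).mul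
      (isRegular_const (polyEval b F v₀)⁻¹)).add
        (isRegular_const (-(polyEval b h₁ v₀ / polyEval b F v₀)))
    convert hreg using 2 with g
    rw [← hdiff g v₀ hv₀, polyEval_map_of_polyComp_eq hFX, sub_eq_add_neg, div_eq_mul_inv,
      mul_inv, mul_assoc]

theorem image_levelSet_subset
    (hFX : ∀ g, polyComp b F (ρ g) = (X g : ℂ) • F) (h : ∀ g : G, F ∣ polyComp b h₁ (ρ g) - (X g : ℂ) • h₁)
    (g : G) (ε : ℂ) : ρ g '' levelSet b F h₁ ε ⊆ levelSet b F h₁ ((X g : ℂ) * ε) := by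
  rintro _ ⟨v, ⟨hv, hv'⟩, rfl⟩
  refine ⟨by rw [polyEval_map_of_polyComp_eq hFX, hv, mul_zero], ?_⟩
  obtain ⟨q, hq⟩ := h g
  have h1 := congrArg (fun p => polyEval b p v) (sub_eq_iff_eq_add.1 hq)
  have h2 : polyEval b (F * q + (X g : ℂ) • h₁) v =
      polyEval b F v * polyEval b q v + X g * polyEval b h₁ v := by simp [polyEval]
  simp only [polyEval_polyComp, h2, hv] at h1
  rw [h1]
  linear_combination (X g : ℂ) * hv'

theorem image_levelSet_eq
    (hFX : ∀ g, polyComp b F (ρ g) = (X g : ℂ) • F) (h : ∀ g : G, F ∣ polyComp b h₁ (ρ g) - (X g : ℂ) • h₁)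
    (g : G) (ε : ℂ) : ρ g '' levelSet b F h₁ ε = levelSet b F h₁ ((X g : ℂ) * ε) := by
  refine (image_levelSet_subset hFX h g ε).antisymm fun v hv => ⟨ρ g⁻¹ v, ?_, by simp⟩
  -- The reverse inclusion is the forward one for `g⁻¹`.
  simpa using image_levelSet_subset hFX h g⁻¹ _ (Set.mem_image_of_mem _ hv)

theorem dvd_of_image_levelSet_eq (hF : Squarefree F)
    (h : ∀ (g : G) (ε : ℂ), ρ g '' levelSet b F h₁ ε = levelSet b F h₁ ((X g : ℂ) * ε))
    (g : G) : F ∣ polyComp b h₁ (ρ g) - (X g : ℂ) • h₁ := by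
  refine dvd_of_squarefree_of_zeroSet_subset (b := b) hF fun v hv => ?_
  -- Every zero `v` of `F` lies on the level set with `ε = h₁ v`.
  have h1 : ρ g v ∈ levelSet b F h₁ ((X g : ℂ) * polyEval b h₁ v) := by
    rw [← h]
    exact ⟨v, ⟨hv, sub_self _⟩, rfl⟩
  have h2 := h1.2
  rw [← polyEval_polyComp] at h2
  simpa [zeroSet, polyEval] using h2

end Equivariant

theorem AreBasicRelativeInvariants.polyEval_ne_zero {r : ℕ} {f : Fin r → MvPolynomial (Fin n) ℂ}
    (hf : AreBasicRelativeInvariants b Ω f) (i : Fin r) {v : V} (hv : v ∈ Ω) :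
    polyEval b (f i) v ≠ 0 := by
  have h : zeroSet b (f i) ∈ {S | IsHypersurfaceComponent b Ω S} := hf.range_eq ▸ ⟨i, rfl⟩
  exact fun h0 => h.1.prop.2 h0 hv

theorem AreBasicRelativeInvariants.not_associated {r : ℕ} {f : Fin r → MvPolynomial (Fin n) ℂ}
    (hf : AreBasicRelativeInvariants b Ω f) (i j : Fin r) (hij : i ≠ j) :
    ¬ Associated (f i) (f j) := by
  rintro ⟨u, hu⟩
  refine hij (hf.injective ?_)
  ext v
  have hu' : polyEval b (u : MvPolynomial (Fin n) ℂ) v ≠ 0 :=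
    (u.isUnit.map (MvPolynomial.eval (b.repr v))).ne_zero
  have : polyEval b (f j) v = polyEval b (f i) v * polyEval b u v := by
    rw [← hu]; simp [polyEval]
  simp [zeroSet, this, hu']

/-- Agreement to order `k - 1` means membership in `(f) ^ k`; `0 < k` keeps the natural subtraction
from truncating. -/
theorem agreeToOrder_sub_one_iff {k : ℕ} (hk : 0 < k) (f p q : MvPolynomial (Fin n) ℂ) :
    AgreeToOrder (k - 1) f p q ↔ f ^ k ∣ p - q := by
  rw [AgreeToOrder, Nat.sub_add_cancel hk, Ideal.span_singleton_pow, Ideal.mem_span_singleton]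

end Prehomogeneous

end PVS

theorem mainTheorem7 {m n r : ℕ} {V : Type*} [AddCommGroup V] [Module ℂ V]
    (b : Module.Basis (Fin n) ℂ V)
    (G : Subgroup (GL (Fin m) ℂ)) (ρ : Representation ℂ G V) (Ω : Set V)
    (hρ : PVS.IsPrehomogeneous b ρ Ω)
    (f : Fin r → MvPolynomial (Fin n) ℂ) (hf : PVS.AreBasicRelativeInvariants b Ω f)
    (χ : Fin r → (G →* ℂˣ))
    (hχ : ∀ i, PVS.IsRelativeInvariantFor b ρ Ω (PVS.ratMk (f i) 1) (χ i))
    (k : Fin r → ℕ) (h₁ F : MvPolynomial (Fin n) ℂ) (d : ℕ)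
    (hF : F = ∏ i, f i ^ k i)
    (hh₁d : h₁.IsHomogeneous d) (hFd : F.IsHomogeneous d)
    (hlow : IsRelPrime h₁ F)
    (X : G →* ℂˣ) (hX : X = ∏ i, χ i ^ k i) :
    List.TFAE
      [PVS.IsAdditiveRelativeInvariant b ρ Ω (PVS.ratMk h₁ F),
        ∀ i, 0 < k i → ∀ g : G,
          PVS.AgreeToOrder (k i - 1) (f i) (PVS.polyComp b h₁ (ρ g)) ((X g : ℂ) • h₁),
        ∀ g : G, F ∣ PVS.polyComp b h₁ (ρ g) - (X g : ℂ) • h₁] ∧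
    (Squarefree F →
      (PVS.IsAdditiveRelativeInvariant b ρ Ω (PVS.ratMk h₁ F) ↔
        ∀ (g : G) (ε : ℂ),
          ρ g '' PVS.levelSet b F h₁ ε = PVS.levelSet b F h₁ ((X g : ℂ) * ε))) := by
  have hFX : ∀ g, PVS.polyComp b F (ρ g) = (X g : ℂ) • F := by
    rw [hF, hX]
    exact PVS.polyComp_prod_pow (fun i => (hχ i).polyComp_eq hρ) k
  have hFΩ : ∀ v ∈ Ω, PVS.polyEval b F v ≠ 0 := fun v hv => by
    simpa [hF, PVS.polyEval, Finset.prod_ne_zero_iff] using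
      fun i => pow_ne_zero (k i) (hf.polyEval_ne_zero i hv)
  have hXreg : PVS.IsRationalCharacter X :=
    hX ▸ PVS.isRationalCharacter_prod _ fun i _ => (hχ i).character.pow (k i)
  have h13 : PVS.IsAdditiveRelativeInvariant b ρ Ω (PVS.ratMk h₁ F) ↔
      ∀ g : G, F ∣ PVS.polyComp b h₁ (ρ g) - (X g : ℂ) • h₁ :=
    ⟨fun h => h.dvd hρ hFX hFΩ,
      PVS.isAdditiveRelativeInvariant_of_dvd hρ hFX hFΩ hXreg hh₁d hFd⟩
  have h23 : (∀ i, 0 < k i → ∀ g : G,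
      PVS.AgreeToOrder (k i - 1) (f i) (PVS.polyComp b h₁ (ρ g)) ((X g : ℂ) • h₁)) ↔
      ∀ g : G, F ∣ PVS.polyComp b h₁ (ρ g) - (X g : ℂ) • h₁ := by
    simp only [hF, PVS.prod_pow_dvd_iff hf.irreducible hf.not_associated]
    refine ⟨fun h g i => ?_, fun h i hi g => (PVS.agreeToOrder_sub_one_iff hi _ _ _).2 (h g i)⟩
    rcases Nat.eq_zero_or_pos (k i) with hi | hi
    -- For `k i = 0` the condition is vacuous, since `f i ^ 0 = 1` divides everything.
    · simp [hi]
    · exact (PVS.agreeToOrder_sub_one_iff hi _ _ _).1 (h i hi g)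
  refine ⟨?_, fun hsq => h13.trans
    ⟨PVS.image_levelSet_eq hFX, PVS.dvd_of_image_levelSet_eq hsq⟩⟩
  tfae_have 1 ↔ 3 := h13
  tfae_have 2 ↔ 3 := h23
  tfae_finish
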